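/- Let $\mathbb K=\mathbb R$ or $\mathbb C$, let $N\ge 0$ be an integer, let $b,\,p_i,\,\xi_{i0},\,c_{ij}\in\mathbb K$ $(1\le i,j\le 2N)$ with $c_{ij}=-c_{ji}$, and assume that $p_i\neq 0$ and $bp_i\ne\pm1$ for all $i$ and that $p_i+p_j\ne 0$ for $i\ne j$. For $l\in\mathbb Z$ and $s,r\in\mathbb K$ put $$\varphi_i^{(0)}(l)=\Big(\frac{1+bp_i}{1-bp_i}\Big)^{l}e^{\xi_i},\qquad \xi_i=\frac{s}{p_i}+\frac{r}{p_i^{3}}+\xi_{i0},$$ and let $\tau_l=\tau_l(s,r)=\mathrm{Pf}(1,2,\dots,2N)_l$ be the Pfaffian with elements $$(i,j)_l=c_{ij}+\frac{p_i-p_j}{p_i+p_j}\,\varphi_i^{(0)}(l)\,\varphi_j^{(0)}(l),$$ defined by $\mathrm{Pf}(1,\dots,2N)=\sum_{j=2}^{2N}(-1)^j(1,j)\,\mathrm{Pf}(2,\dots,\widehat{j},\dots,2N)$, the empty Pfaffian being $1$. Let $D_s,D_r$ be Hirota's operators: for a polynomial $P$, $$P(D_s,D_r)f\cdot g=P\big(\partial_s-\partial_{s'},\,\partial_r-\partial_{r'}\big)\,f(s,r)\,g(s',r')\big|_{s'=s,\;r'=r}.$$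 Then every $\tau_l$ is a smooth function of $(s,r)$, and for all $l\in\mathbb Z$ and all $s,r\in\mathbb K$ $$\big((D_s-b)^3-(D_r-b^3)\big)\,\tau_{l+1}\cdot\tau_l=0 .$$ Suppose moreover that $c_{ij}=0$ unless $j=2N+1-i$, and that $$p_i^3\,(1-b^2p_{2N+1-i}^2)=-\,p_{2N+1-i}^3\,(1-b^2p_i^2)\qquad(1\le i\le 2N).$$ Then for all $l\in\mathbb Z$ and all $s,r\in\mathbb K$ $$\partial_r\tau_l=b^2\,\partial_s\tau_l\qquad\text{and}\qquad \big(D_s^3-3b\,D_s^2+2b^2D_s\big)\,\tau_{l+1}\cdot\tau_l=0 .$$ -/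

import Mathlib

open scoped ContDiff

/-- The Pfaffian `Pf(1, …, n)` of a triangular array with entries `A i j`, `i < j`, by expansion
along the first row: `Pf(1, …, n) = ∑_{j=2}^{n} (-1)^j (1, j) Pf(2, …, ĵ, …, n)`; the empty
Pfaffian is `1`, and a Pfaffian of odd order is `0`. The summation index `j` below runs from `0`,
so it stands for the label `j + 2`. -/
def pfaffian {R : Type*} [CommRing R] : {n : ℕ} → Matrix (Fin n) (Fin n) R → R
  | 0, _ => 1
  | 1, _ => 0
  | n + 2, A =>
      ∑ j : Fin (n + 1), (-1) ^ (j : ℕ) * A 0 j.succ *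
        pfaffian (A.submatrix (fun i : Fin n => (j.succAbove i).succ)
          (fun i : Fin n => (j.succAbove i).succ))

section Tau

variable {𝕜 : Type*} [RCLike 𝕜]

/-- The phase `ξ = s / p + r / p ^ 3 + ξ₀`. -/
def phase (p ξ₀ s r : 𝕜) : 𝕜 := s / p + r / p ^ 3 + ξ₀

/-- `φ^{(0)}(l) = ((1 + b p) / (1 - b p)) ^ l * exp ξ`, with `l` an integer lattice index. -/
noncomputable def phi (b p ξ₀ : 𝕜) (l : ℤ) (s r : 𝕜) : 𝕜 :=
  ((1 + b * p) / (1 - b * p)) ^ l * NormedSpace.exp (phase p ξ₀ s r)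

/-- The Pfaffian `τ_l(s, r)` with elements
`(i, j)_l = c i j + (p i - p j) / (p i + p j) * φ_i^{(0)}(l) * φ_j^{(0)}(l)`. -/
noncomputable def tau {N : ℕ} (b : 𝕜) (p ξ₀ : Fin (2 * N) → 𝕜)
    (c : Matrix (Fin (2 * N)) (Fin (2 * N)) 𝕜) (l : ℤ) (s r : 𝕜) : 𝕜 :=
  pfaffian (Matrix.of fun i j => c i j +
    (p i - p j) / (p i + p j) * phi b (p i) (ξ₀ i) l s r * phi b (p j) (ξ₀ j) l s r)

end Tau

section Hirota

variable {𝕜 : Type*} [RCLike 𝕜]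

/-- Functions `F s r s' r'` of two copies of the variables `(s, r)`. -/
abbrev DoubledFun (𝕜 : Type*) : Type _ := 𝕜 → 𝕜 → 𝕜 → 𝕜 → 𝕜

/-- The operator `∂/∂s - ∂/∂s'`. -/
noncomputable def hirotaDs : DoubledFun 𝕜 → DoubledFun 𝕜 := fun F s r s' r' =>
  deriv (fun x => F x r s' r') s - deriv (fun x => F s r x r') s'

/-- The operator `∂/∂r - ∂/∂r'`. -/
noncomputable def hirotaDr : DoubledFun 𝕜 → DoubledFun 𝕜 := fun F s r s' r' =>
  deriv (fun x => F s x s' r') r - deriv (fun x => F s r s' x) r'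

/-- `P f · g` at `(s, r)` for an operator `P` built from `D_s` and `D_r`: apply `P` to
`f(s, r) g(s', r')`, then put `s' = s` and `r' = r`. -/
def hirota (P : DoubledFun 𝕜 → DoubledFun 𝕜) (f g : 𝕜 → 𝕜 → 𝕜) (s r : 𝕜) : 𝕜 :=
  P (fun s r s' r' => f s r * g s' r') s r s r

end Hirota

/-!
The bilinear equation reduces to one quadratic identity between Pfaffians.

Write `A` for the matrix of `τ_l` and `f ∧ g` for `f gᵀ - g fᵀ`. The factors
`(p_i - p_j) / (p_i + p_j)` are such that `∂_s A`, `∂_r A` and `A_{l+1} - A_l` are combinations of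
at most two matrices `f ∧ g`: with `e_k = φ / p ^ k` and `x = φ / (1 - b p)`,

* `∂_s A = e₀ ∧ e₁` and `∂_r A = e₀ ∧ e₃ - 2 e₁ ∧ e₂`,
* `A_{l+1} = A_l + 2 x ∧ e₀`, and `∂_s x = e₁ + b x`.

The Pfaffian is affine along `f ∧ g`, with slope `⟨f, g⟩ = Pf(A + f ∧ g) - Pf A` (`pfTwo`), and the
slope of `⟨f, g⟩` along `h ∧ k` is an alternating quantity `⟨f, g, h, k⟩` (`pfFour`). Hence all
derivatives of `τ_l` and of `τ_{l+1} = τ_l + 2 ⟨x, e₀⟩` are combinations of a few brackets, and the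
bilinear equation becomes six times (`hirota_tau`)
`Pf A ⟨x, e₀, e₁, e₂⟩ = ⟨x, e₀⟩⟨e₁, e₂⟩ - ⟨x, e₁⟩⟨e₀, e₂⟩ + ⟨x, e₂⟩⟨e₀, e₁⟩`.

This identity (`pfFour_plucker`) and the properties of the brackets come from the exterior algebra.
The Pfaffian is the Gaussian expectation (`wick`) of the volume element `vol` of `𝕜ⁿ`, an update by
`f ∧ g` inserts the contractions with `f` and `g`, and contraction with a covector `f = aᵀ A`
amounts to multiplication by `a`, which annihilates `vol`. This proves the identity for invertible
`A`, and continuity gives the rest.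

In the reduced case the flow along `∂_r - b² ∂_s` acts on `A` by a diagonal congruence of
determinant one, which leaves the Pfaffian unchanged (`tau_flow`).
-/

/-! ### The Gaussian functional on the exterior algebra -/

section Wick

open ExteriorAlgebra CliffordAlgebra

variable {R M : Type*} [CommRing R] [AddCommGroup M] [Module R M]

/-- The Gaussian expectation on the exterior algebra with covariance `B`, an alternating form:
deform the exterior product by `-B` with `CliffordAlgebra.changeForm`, then take the scalar part.
The hypothesis `hB` says that `B` is alternating, in the form which `changeForm` asks for. The sign
is such that the expectation of `m₁ ∧ m₂` is `B m₁ m₂`. -/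
noncomputable def wick (B : LinearMap.BilinForm R M)
    (hB : (-B).toQuadraticMap = (0 : QuadraticForm R M) - 0) : ExteriorAlgebra R M →ₗ[R] R :=
  (algebraMapInv : ExteriorAlgebra R M →ₐ[R] R).toLinearMap ∘ₗ changeForm hB

variable {B : LinearMap.BilinForm R M} (hB : (-B).toQuadraticMap = (0 : QuadraticForm R M) - 0)

theorem wick_one : wick B hB 1 = 1 := by
  simp [wick]

/-- Wick's rule: a leading vector `m` can be replaced by contraction with the covector `B m`. -/
theorem wick_ι_mul (m : M) (x : ExteriorAlgebra R M) :
    wick B hB (ι R m * x) = wick B hB (contractLeft (B m) x) := by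
  simp only [wick, LinearMap.comp_apply, changeForm_ι_mul, changeForm_contractLeft]
  simp [algebraMapInv]

theorem contractLeft_ιMulti {n : ℕ} (d : Module.Dual R M) (w : Fin (n + 1) → M) :
    contractLeft d (ιMulti R (n + 1) w) =
      ∑ j : Fin (n + 1), ((-1) ^ (j : ℕ) * d (w j)) • ιMulti R n (w ∘ j.succAbove) := by
  induction n with
  | zero =>
    rw [ιMulti_succ_apply, contractLeft_ι_mul]
    simp
  | succ n ih =>
    rw [ιMulti_succ_apply, contractLeft_ι_mul, ih, Fin.sum_univ_succ (n := n + 1)]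
    rw [sub_eq_add_neg, Finset.mul_sum, ← Finset.sum_neg_distrib]
    congr 1
    · rw [Fin.val_zero, pow_zero, one_mul]
      rfl
    · refine Finset.sum_congr rfl fun j _ => ?_
      rw [ιMulti_succ_apply, Fin.val_succ, pow_succ, mul_neg_one, neg_mul, neg_smul,
        mul_smul_comm]
      simp only [Function.comp_apply, Fin.succ_succAbove_zero]
      congr 4
      ext i
      simp [Matrix.vecTail]

/-- The Pfaffian of the Gram matrix of vectors `w i` is the expectation of their wedge product:
Wick's rule is the expansion of the Pfaffian along its first row. -/
theorem pfaffian_eq_wick {n : ℕ} (w : Fin n → M) :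
    pfaffian (Matrix.of fun i j => B (w i) (w j)) = wick B hB (ιMulti R n w) := by
  induction n using Nat.twoStepInduction with
  | zero => simp [pfaffian, wick_one]
  | one =>
    rw [ιMulti_succ_apply, wick_ι_mul]
    simp [pfaffian]
  | more n ih _ =>
    rw [ιMulti_succ_apply, wick_ι_mul, contractLeft_ιMulti, map_sum, pfaffian]
    refine Finset.sum_congr rfl fun j _ => ?_
    rw [map_smul, ← ih, smul_eq_mul]
    rfl

/-- Deforming the exterior product by a decomposable 2-form of covectors is `1 + i_g i_f`; the
exponential series stops there because `i_f` and `i_g` anticommute and square to zero. -/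
theorem changeForm_wedge (f g : Module.Dual R M) {C : LinearMap.BilinForm R M}
    (hC : C.toQuadraticMap = (0 : QuadraticForm R M) - 0)
    (h : ∀ m, C m = g m • f - f m • g) (x : ExteriorAlgebra R M) :
    changeForm hC x = x + contractLeft g (contractLeft f x) := by
  induction x using CliffordAlgebra.left_induction with
  | algebraMap r => simp
  | add x y hx hy => simp only [map_add, hx, hy]; abel
  | ι_mul x m hx =>
    rw [changeForm_ι_mul, hx, h]
    have h1 : contractLeft f (contractLeft g (contractLeft f x)) = 0 := by
      rw [contractLeft_comm f g, contractLeft_contractLeft, map_zero, neg_zero]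
    simp only [map_add, map_sub, map_smul, LinearMap.sub_apply, LinearMap.smul_apply,
      contractLeft_ι_mul, h1, contractLeft_contractLeft, mul_add, smul_zero]
    abel

theorem wick_add_wedge (f g : Module.Dual R M) {B' : LinearMap.BilinForm R M}
    (hB' : (-B').toQuadraticMap = (0 : QuadraticForm R M) - 0)
    (h : ∀ m, B' m = B m + (f m • g - g m • f)) (x : ExteriorAlgebra R M) :
    wick B' hB' x = wick B hB x + wick B hB (contractLeft g (contractLeft f x)) := by
  have hC : (B - B').toQuadraticMap = (0 : QuadraticForm R M) - 0 := by
    ext m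
    simp [h m, mul_comm]
  have h2 : -B + (B - B') = -B' := by abel
  have := changeForm_changeForm hB hC x
  simp only [h2] at this
  rw [wick, wick, LinearMap.comp_apply, ← this,
    changeForm_wedge f g hC (fun m => by simp [h m])]
  simp [changeForm_contractLeft]

/-- The Pfaffian Plücker relation, for a form `B`, when the first covector is `B a`. By
`wick_ι_mul`, contraction with `B a` may be traded for multiplication by `a`; since `vol` is
annihilated by all vectors, moving `a` to the right through the contractions leaves only pairings
with `a`. -/
theorem wick_plucker (vol : ExteriorAlgebra R M) (hvol : ∀ m, ι R m * vol = 0) (a : M)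
    (g h k : Module.Dual R M) :
    wick B hB vol * wick B hB (contractLeft (B a) (contractLeft g (contractLeft h
      (contractLeft k vol)))) =
    wick B hB (contractLeft (B a) (contractLeft g vol)) *
      wick B hB (contractLeft h (contractLeft k vol)) -
    wick B hB (contractLeft (B a) (contractLeft h vol)) *
      wick B hB (contractLeft g (contractLeft k vol)) +
    wick B hB (contractLeft (B a) (contractLeft k vol)) *
      wick B hB (contractLeft g (contractLeft h vol)) := by
  have key (d : Module.Dual R M) (x : ExteriorAlgebra R M) :
      ι R a * contractLeft d x = d a • x - contractLeft d (ι R a * x) := by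
    rw [contractLeft_ι_mul]; abel
  simp only [← wick_ι_mul, key, hvol, map_sub, map_smul, map_zero, smul_eq_mul, sub_zero]
  ring

end Wick

/-! ### Rank-two updates of Pfaffians -/

section Bracket

open ExteriorAlgebra CliffordAlgebra

variable {K : Type*} [Field K] {n : ℕ}

/-- The rank-two skew-symmetric matrix `f gᵀ - g fᵀ`. -/
def wedge (f g : Fin n → K) : Matrix (Fin n) (Fin n) K :=
  Matrix.vecMulVec f g - Matrix.vecMulVec g f

/-- The change of the Pfaffian under the rank-two update by `f ∧ g`. For skew-symmetric `A` it is
bilinear and alternating in `f, g`. -/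
def pfTwo (A : Matrix (Fin n) (Fin n) K) (f g : Fin n → K) : K :=
  pfaffian (A + wedge f g) - pfaffian A

/-- The second difference of the Pfaffian under the updates by `f ∧ g` and `h ∧ k`. For
skew-symmetric `A` it is multilinear and alternating in its four vectors. -/
def pfFour (A : Matrix (Fin n) (Fin n) K) (f g h k : Fin n → K) : K :=
  pfTwo (A + wedge h k) f g - pfTwo A f g

theorem transpose_wedge (f g : Fin n → K) : (wedge f g).transpose = -wedge f g := by
  simp [wedge, Matrix.transpose_vecMulVec]

theorem transpose_add_wedge {A : Matrix (Fin n) (Fin n) K} (hA : A.transpose = -A)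
    (f g : Fin n → K) : (A + wedge f g).transpose = -(A + wedge f g) := by
  rw [Matrix.transpose_add, hA, transpose_wedge, neg_add]

/-- The volume element `e₁ ∧ ⋯ ∧ eₙ` of `Kⁿ`. -/
noncomputable def volForm (K : Type*) [Field K] (n : ℕ) : ExteriorAlgebra K (Fin n → K) :=
  ιMulti K n fun i => Pi.single i 1

/-- The volume element has top degree, so every vector annihilates it. -/
theorem ι_mul_volForm (m : Fin n → K) : ExteriorAlgebra.ι K m * volForm K n = 0 := by
  rw [pi_eq_sum_univ' m, map_sum, Finset.sum_mul]
  refine Finset.sum_eq_zero fun i _ => ?_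
  rw [map_smul, smul_mul_assoc]
  rw [volForm, ιMulti_apply, ExteriorAlgebra.ι_mul_prod_list (fun i => Pi.single i (1 : K)) i,
    smul_zero]

theorem toBilin'_eq (A : Matrix (Fin n) (Fin n) K) (m : Fin n → K) :
    Matrix.toBilin' A m = dotProductBilin K K (Matrix.vecMul m A) := by
  refine LinearMap.ext fun v => ?_
  rw [Matrix.toBilin'_apply', Matrix.dotProduct_mulVec]
  rfl

variable [CharZero K]

theorem toQuadraticMap_neg_toBilin' {A : Matrix (Fin n) (Fin n) K} (hA : A.transpose = -A) :
    (-Matrix.toBilin' A).toQuadraticMap = (0 : QuadraticForm K (Fin n → K)) - 0 := by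
  ext v
  have h : dotProduct v (A.mulVec v) = -dotProduct v (A.mulVec v) := by
    conv_lhs => rw [Matrix.dotProduct_mulVec, ← Matrix.mulVec_transpose, hA, Matrix.neg_mulVec,
      neg_dotProduct, dotProduct_comm]
  simp [Matrix.toBilin'_apply', self_eq_neg.mp h]

theorem pfaffian_eq_wick_volForm {A : Matrix (Fin n) (Fin n) K} (hA : A.transpose = -A) :
    pfaffian A = wick _ (toQuadraticMap_neg_toBilin' hA) (volForm K n) := by
  rw [volForm, ← pfaffian_eq_wick]
  congr 1
  ext i j
  simp [Matrix.toBilin'_single]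

theorem wick_toBilin'_add_wedge {A : Matrix (Fin n) (Fin n) K} (hA : A.transpose = -A)
    (f g : Fin n → K) (x : ExteriorAlgebra K (Fin n → K)) :
    wick _ (toQuadraticMap_neg_toBilin' (transpose_add_wedge hA f g)) x =
      wick _ (toQuadraticMap_neg_toBilin' hA) x - wick _ (toQuadraticMap_neg_toBilin' hA)
        (contractLeft (dotProductBilin K K f) (contractLeft (dotProductBilin K K g) x)) := by
  rw [wick_add_wedge (toQuadraticMap_neg_toBilin' hA) (dotProductBilin K K f)
    (dotProductBilin K K g), contractLeft_comm, map_neg, sub_eq_add_neg]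
  intro m
  rw [toBilin'_eq, toBilin'_eq, wedge, Matrix.vecMul_add, Matrix.vecMul_sub,
    Matrix.vecMul_vecMulVec, Matrix.vecMul_vecMulVec, map_add, map_sub]
  refine LinearMap.ext fun v => ?_
  simp [dotProductBilin, dotProduct_comm]

theorem pfTwo_eq_wick {A : Matrix (Fin n) (Fin n) K} (hA : A.transpose = -A) (f g : Fin n → K) :
    pfTwo A f g = -wick _ (toQuadraticMap_neg_toBilin' hA)
      (contractLeft (dotProductBilin K K f) (contractLeft (dotProductBilin K K g)
        (volForm K n))) := by
  rw [pfTwo, pfaffian_eq_wick_volForm hA, pfaffian_eq_wick_volForm (transpose_add_wedge hA f g),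
    wick_toBilin'_add_wedge hA]
  ring

theorem pfFour_eq_wick {A : Matrix (Fin n) (Fin n) K} (hA : A.transpose = -A)
    (f g h k : Fin n → K) :
    pfFour A f g h k = wick _ (toQuadraticMap_neg_toBilin' hA)
      (contractLeft (dotProductBilin K K f) (contractLeft (dotProductBilin K K g)
        (contractLeft (dotProductBilin K K h) (contractLeft (dotProductBilin K K k)
          (volForm K n))))) := by
  rw [pfFour, pfTwo_eq_wick hA, pfTwo_eq_wick (transpose_add_wedge hA h k),
    wick_toBilin'_add_wedge hA, contractLeft_comm (dotProductBilin K K k) (dotProductBilin K K f),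
    map_neg, contractLeft_comm (dotProductBilin K K h) (dotProductBilin K K f),
    contractLeft_comm (dotProductBilin K K k) (dotProductBilin K K g)]
  simp only [map_neg]
  rw [contractLeft_comm (dotProductBilin K K h) (dotProductBilin K K g)]
  simp only [map_neg]
  ring

section
variable {A : Matrix (Fin n) (Fin n) K} (hA : A.transpose = -A) (f f' g h k : Fin n → K)
include hA

theorem pfTwo_swap : pfTwo A f g = -pfTwo A g f := by
  rw [pfTwo_eq_wick hA, pfTwo_eq_wick hA, contractLeft_comm, map_neg]

theorem pfTwo_self : pfTwo A f f = 0 := by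
  rw [pfTwo_eq_wick hA, contractLeft_contractLeft, map_zero, neg_zero]

theorem pfTwo_add_left : pfTwo A (f + f') g = pfTwo A f g + pfTwo A f' g := by
  simp only [pfTwo_eq_wick hA, map_add, LinearMap.add_apply]
  ring

theorem pfTwo_smul_left (a : K) : pfTwo A (a • f) g = a * pfTwo A f g := by
  simp only [pfTwo_eq_wick hA, map_smul, LinearMap.smul_apply, smul_eq_mul]
  ring

theorem pfFour_swap_left : pfFour A f g h k = -pfFour A g f h k := by
  rw [pfFour_eq_wick hA, pfFour_eq_wick hA, contractLeft_comm, map_neg]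

theorem pfFour_swap_mid : pfFour A f g h k = -pfFour A f h g k := by
  rw [pfFour_eq_wick hA, pfFour_eq_wick hA,
    contractLeft_comm (dotProductBilin K K g), map_neg, map_neg]

theorem pfFour_swap_right : pfFour A f g h k = -pfFour A f g k h := by
  rw [pfFour_eq_wick hA, pfFour_eq_wick hA,
    contractLeft_comm (dotProductBilin K K h), map_neg, map_neg, map_neg]

theorem pfFour_self_mid : pfFour A f g g k = 0 := by
  rw [pfFour_eq_wick hA, contractLeft_contractLeft, map_zero, map_zero]

theorem pfFour_self_right : pfFour A f g h h = 0 := by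
  rw [pfFour_eq_wick hA, contractLeft_contractLeft, map_zero, map_zero, map_zero]

theorem pfFour_smul_third (a : K) : pfFour A f g (a • h) k = a * pfFour A f g h k := by
  simp only [pfFour_eq_wick hA, map_smul, LinearMap.smul_apply, smul_eq_mul]

/-- The four-vector identity for invertible `A`, where every covector `f` has the form `aᵀ A`. -/
theorem pfFour_plucker_of_det_ne_zero (hdet : A.det ≠ 0) :
    pfaffian A * pfFour A f g h k =
      pfTwo A f g * pfTwo A h k - pfTwo A f h * pfTwo A g k + pfTwo A f k * pfTwo A g h := by
  have ha : dotProductBilin K K f = Matrix.toBilin' A (Matrix.vecMul f A⁻¹) := by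
    rw [toBilin'_eq, Matrix.vecMul_vecMul, Matrix.nonsing_inv_mul _ (isUnit_iff_ne_zero.mpr hdet),
      Matrix.vecMul_one]
  simp only [pfTwo_eq_wick hA, pfFour_eq_wick hA, pfaffian_eq_wick_volForm hA, neg_mul_neg, ha]
  exact wick_plucker _ _ ι_mul_volForm _ _ _ _

end

end Bracket

/-! ### A generic skew-symmetric direction -/

section Even

variable {K : Type*} [Field K]

/-- The antidiagonal matrix with entries `1` above and `-1` below the diagonal; it is
skew-symmetric and invertible when `n` is even. -/
def antidiagSkew (K : Type*) [Field K] (n : ℕ) : Matrix (Fin n) (Fin n) K :=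
  Matrix.of fun i j => if j = i.rev then (if i < j then 1 else -1) else 0

theorem rev_lt_iff_not_lt_rev {N : ℕ} (i : Fin (2 * N)) : i.rev < i ↔ ¬ i < i.rev := by
  simp only [Fin.lt_def, Fin.val_rev]
  omega

theorem transpose_antidiagSkew (N : ℕ) :
    (antidiagSkew K (2 * N)).transpose = -antidiagSkew K (2 * N) := by
  ext i j
  simp only [antidiagSkew, Matrix.transpose_apply, Matrix.of_apply, Matrix.neg_apply]
  by_cases h : j = i.rev
  · subst h
    simp only [Fin.rev_rev, rev_lt_iff_not_lt_rev, if_true]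
    split_ifs <;> simp
  · have h' : i ≠ j.rev := fun e => h (by rw [e, Fin.rev_rev])
    simp [h, h']

theorem det_antidiagSkew_ne_zero (N : ℕ) : (antidiagSkew K (2 * N)).det ≠ 0 := by
  have h : antidiagSkew K (2 * N) * antidiagSkew K (2 * N) = -1 := by
    ext i j
    simp only [antidiagSkew, Matrix.mul_apply, Matrix.of_apply, ite_mul, zero_mul]
    rw [Finset.sum_ite_eq' Finset.univ i.rev]
    simp only [Fin.rev_rev, Matrix.neg_apply, Matrix.one_apply, eq_comm (a := j)]
    by_cases h : i = j
    · subst h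
      simp only [Finset.mem_univ, if_true, rev_lt_iff_not_lt_rev]
      split_ifs <;> simp
    · simp [h]
  intro h0
  have := congrArg Matrix.det h
  rw [Matrix.det_mul, h0, zero_mul, Matrix.det_neg, Matrix.det_one] at this
  simp at this

end Even

/-! ### Derivatives of Pfaffians and the four-vector identity -/

section Calculus

variable {𝕜 : Type*} [RCLike 𝕜] {n : ℕ}

theorem contDiff_pfaffian :
    ContDiff 𝕜 ∞ fun a : Fin n → Fin n → 𝕜 => pfaffian (Matrix.of a) := by
  induction n using Nat.twoStepInduction with
  | zero => simpa only [pfaffian] using contDiff_const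
  | one => simpa only [pfaffian] using contDiff_const
  | more n ih _ =>
    simp only [pfaffian]
    refine ContDiff.sum fun j _ => (contDiff_const.mul ?_).mul
      (ih.comp (f := fun (a : Fin (n + 2) → Fin (n + 2) → 𝕜) i k =>
        a (j.succAbove i).succ (j.succAbove k).succ) ?_)
    · exact contDiff_apply_apply 𝕜 𝕜 0 j.succ
    · refine contDiff_pi.mpr fun i => contDiff_pi.mpr fun k => ?_
      exact contDiff_apply_apply 𝕜 𝕜 (j.succAbove i).succ (j.succAbove k).succ

theorem continuous_pfaffian : Continuous fun A : Matrix (Fin n) (Fin n) 𝕜 => pfaffian A :=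
  (contDiff_pfaffian (𝕜 := 𝕜) (n := n)).continuous

/-- The derivative of the Pfaffian at `A` in the direction `H`. It is taken on arrays
`Fin n → Fin n → 𝕜`, which carry a norm. -/
noncomputable def pfaffianDeriv (A H : Matrix (Fin n) (Fin n) 𝕜) : 𝕜 :=
  fderiv 𝕜 (fun a : Fin n → Fin n → 𝕜 => pfaffian (Matrix.of a)) (Matrix.of.symm A)
    (Matrix.of.symm H)

theorem pfaffianDeriv_add (A H H' : Matrix (Fin n) (Fin n) 𝕜) :
    pfaffianDeriv A (H + H') = pfaffianDeriv A H + pfaffianDeriv A H' :=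
  map_add (fderiv 𝕜 (fun a : Fin n → Fin n → 𝕜 => pfaffian (Matrix.of a)) (Matrix.of.symm A))
    (Matrix.of.symm H) (Matrix.of.symm H')

theorem hasDerivAt_pfaffian_comp {A : 𝕜 → Matrix (Fin n) (Fin n) 𝕜}
    {A' : Matrix (Fin n) (Fin n) 𝕜} {t : 𝕜}
    (hA : ∀ i j, HasDerivAt (fun u => A u i j) (A' i j) t) :
    HasDerivAt (fun u => pfaffian (A u)) (pfaffianDeriv (A t) A') t := by
  have h : HasDerivAt (fun u i j => A u i j) (fun i j => A' i j) t :=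
    hasDerivAt_pi.mpr fun i => hasDerivAt_pi.mpr fun j => hA i j
  exact ((contDiff_pfaffian.differentiable (by simp)).differentiableAt.hasFDerivAt
    (x := fun i j => A t i j)).comp_hasDerivAt t h

/-- In a rank-two direction the Pfaffian is affine, so that its derivative is a difference. -/
theorem pfaffianDeriv_wedge {A : Matrix (Fin n) (Fin n) 𝕜} (hA : A.transpose = -A)
    (f g : Fin n → 𝕜) : pfaffianDeriv A (wedge f g) = pfTwo A f g := by
  have h1 : HasDerivAt (fun t : 𝕜 => pfaffian (A + t • wedge f g))
      (pfaffianDeriv (A + (0 : 𝕜) • wedge f g) (wedge f g)) 0 := by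
    refine hasDerivAt_pfaffian_comp fun i j => ?_
    simpa using ((hasDerivAt_id (0 : 𝕜)).mul_const (wedge f g i j)).const_add (A i j)
  have h2 : (fun t : 𝕜 => pfaffian (A + t • wedge f g)) =
      fun t => pfaffian A + t * pfTwo A f g := by
    ext t
    rw [← pfTwo_smul_left hA, pfTwo]
    simp [wedge, Matrix.smul_vecMulVec, Matrix.vecMulVec_smul, smul_sub]
  rw [h2, zero_smul, add_zero] at h1
  have h3 : HasDerivAt (fun t : 𝕜 => pfaffian A + t * pfTwo A f g) (pfTwo A f g) 0 := by
    simpa using ((hasDerivAt_id (0 : 𝕜)).mul_const (pfTwo A f g)).const_add (pfaffian A)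
  exact h1.unique h3

theorem hasDerivAt_wedge {f g : 𝕜 → Fin n → 𝕜} {f' g' : Fin n → 𝕜} {t : 𝕜}
    (hf : ∀ i, HasDerivAt (fun u => f u i) (f' i) t)
    (hg : ∀ i, HasDerivAt (fun u => g u i) (g' i) t) (i j : Fin n) :
    HasDerivAt (fun u => wedge (f u) (g u) i j) ((wedge f' (g t) + wedge (f t) g') i j) t := by
  refine (((hf i).mul (hg j)).sub ((hg i).mul (hf j))).congr_deriv ?_
  simp only [wedge, Matrix.add_apply, Matrix.sub_apply, Matrix.vecMulVec_apply]
  ring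

section
variable {A : 𝕜 → Matrix (Fin n) (Fin n) 𝕜} {t : 𝕜} {h₁ k₁ h₂ k₂ : Fin n → 𝕜}

theorem hasDerivAt_pfaffian (hA : (A t).transpose = -A t)
    (hd : ∀ i j, HasDerivAt (fun u => A u i j) ((wedge h₁ k₁ + wedge h₂ k₂) i j) t) :
    HasDerivAt (fun u => pfaffian (A u)) (pfTwo (A t) h₁ k₁ + pfTwo (A t) h₂ k₂) t := by
  rw [← pfaffianDeriv_wedge hA, ← pfaffianDeriv_wedge hA, ← pfaffianDeriv_add]
  exact hasDerivAt_pfaffian_comp hd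

/-- A derivation rule which is linear in the directions `h ∧ k` of the matrix: the terms in which
a vector of `f, g` would occur twice vanish. Two rank-two directions are enough for both flows of
the tau function. -/
theorem hasDerivAt_pfTwo (hA : (A t).transpose = -A t)
    (hd : ∀ i j, HasDerivAt (fun u => A u i j) ((wedge h₁ k₁ + wedge h₂ k₂) i j) t)
    {f g : 𝕜 → Fin n → 𝕜} {f' g' : Fin n → 𝕜}
    (hf : ∀ i, HasDerivAt (fun u => f u i) (f' i) t)
    (hg : ∀ i, HasDerivAt (fun u => g u i) (g' i) t) :
    HasDerivAt (fun u => pfTwo (A u) (f u) (g u))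
      (pfTwo (A t) f' (g t) + pfTwo (A t) (f t) g' +
        pfFour (A t) (f t) (g t) h₁ k₁ + pfFour (A t) (f t) (g t) h₂ k₂) t := by
  have hB := transpose_add_wedge hA (f t) (g t)
  have hcomp := hasDerivAt_pfaffian_comp (A := fun u => A u + wedge (f u) (g u))
    (A' := wedge h₁ k₁ + wedge h₂ k₂ + (wedge f' (g t) + wedge (f t) g'))
    fun i j => (hd i j).add (hasDerivAt_wedge hf hg i j)
  refine (hcomp.sub (hasDerivAt_pfaffian hA hd)).congr_deriv ?_
  simp only [pfaffianDeriv_add, pfaffianDeriv_wedge hB]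
  have e (h k : Fin n → 𝕜) : pfTwo (A t + wedge (f t) (g t)) h k =
      pfTwo (A t) h k + pfFour (A t) (f t) (g t) h k := by
    rw [pfFour_swap_mid hA, pfFour_swap_left hA, pfFour_swap_right hA, pfFour_swap_mid hA, pfFour]
    ring
  have z1 (f g k : Fin n → 𝕜) : pfFour (A t) f g k g = 0 := by
    rw [pfFour_swap_right hA, pfFour_self_mid hA, neg_zero]
  have z2 (f g k : Fin n → 𝕜) : pfFour (A t) f g f k = 0 := by
    rw [pfFour_swap_left hA, pfFour_self_mid hA, neg_zero]
  simp only [e, z1, z2]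
  ring

end

/-- The four-vector identity for every skew-symmetric matrix of even order. Both sides are
continuous in `A`, and `A + t J` is invertible for all but finitely many `t`, where `J` is an
invertible skew-symmetric matrix. -/
theorem pfFour_plucker {N : ℕ} {A : Matrix (Fin (2 * N)) (Fin (2 * N)) 𝕜}
    (hA : A.transpose = -A) (f g h k : Fin (2 * N) → 𝕜) :
    pfaffian A * pfFour A f g h k =
      pfTwo A f g * pfTwo A h k - pfTwo A f h * pfTwo A g k + pfTwo A f k * pfTwo A g h := by
  set J := antidiagSkew 𝕜 (2 * N) with hJ
  have hc : Continuous fun t : 𝕜 => A + t • J := by fun_prop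
  have hpf (C : Matrix (Fin (2 * N)) (Fin (2 * N)) 𝕜) :
      Continuous fun t : 𝕜 => pfaffian (A + t • J + C) :=
    continuous_pfaffian.comp (hc.add continuous_const)
  have hpf0 : Continuous fun t : 𝕜 => pfaffian (A + t • J) :=
    continuous_pfaffian.comp hc
  have h2 (f g) : Continuous fun t : 𝕜 => pfTwo (A + t • J) f g := (hpf _).sub hpf0
  have h4 (f g h k) : Continuous fun t : 𝕜 => pfFour (A + t • J) f g h k := by
    refine Continuous.sub (Continuous.sub ?_ (hpf _)) (h2 f g)
    simpa only [add_assoc] using hpf (wedge h k + wedge f g)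
  have hgen : ∀ᶠ t in nhdsWithin (0 : 𝕜) {0}ᶜ, (A + t • J).det ≠ 0 := by
    -- the leading coefficient of this polynomial in `t` is `J.det`
    set P := Matrix.det ((Polynomial.X : Polynomial 𝕜) • J.map Polynomial.C +
      A.map Polynomial.C) with hP
    have hP0 : P ≠ 0 := by
      intro h0
      have := Polynomial.coeff_det_X_add_C_card J A
      rw [← hP, h0, Polynomial.coeff_zero] at this
      exact det_antidiagSkew_ne_zero N this.symm
    have heval (t : 𝕜) : P.eval t = (A + t • J).det := by
      rw [hP, ← Polynomial.coe_evalRingHom, RingHom.map_det]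
      congr 1
      ext i j
      simp [add_comm]
      exact mul_comm _ _
    refine Filter.Eventually.filter_mono (nhdsNE_le_cofinite 0) ?_
    refine (P.roots.toFinset.finite_toSet.eventually_cofinite_notMem).mono fun t ht h0 => ht ?_
    exact Finset.mem_coe.mpr
      (Multiset.mem_toFinset.mpr ((Polynomial.mem_roots hP0).mpr ((heval t).trans h0)))
  have key := tendsto_nhds_unique_of_eventuallyEq (l := nhdsWithin (0 : 𝕜) {0}ᶜ)
    ((hpf0.mul (h4 f g h k)).continuousWithinAt (x := 0) )
    (((((h2 f g).mul (h2 h k)).sub ((h2 f h).mul (h2 g k))).add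
      ((h2 f k).mul (h2 g h))).continuousWithinAt (x := 0))
    (hgen.mono fun t ht => pfFour_plucker_of_det_ne_zero
      (by rw [Matrix.transpose_add, Matrix.transpose_smul, hA, hJ, transpose_antidiagSkew, smul_neg,
        neg_add]) f g h k ht)
  simpa using key

end Calculus

/-! ### Hirota operators on external products -/

section Hirota

variable {𝕜 : Type*} [RCLike 𝕜]

theorem hirotaDs_sub_smul_eq (a : 𝕜) {F F₁ F₂ G : DoubledFun 𝕜}
    (h₁ : ∀ s r s' r', HasDerivAt (fun x => F x r s' r') (F₁ s r s' r') s)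
    (h₂ : ∀ s r s' r', HasDerivAt (fun x => F s r x r') (F₂ s r s' r') s')
    (hG : ∀ s r s' r', F₁ s r s' r' - F₂ s r s' r' - a * F s r s' r' = G s r s' r') :
    (hirotaDs - a • id : DoubledFun 𝕜 → DoubledFun 𝕜) F = G := by
  funext s r s' r'
  rw [← hG, ← (h₁ s r s' r').deriv, ← (h₂ s r s' r').deriv]
  rfl

/-- The external product `f(s, r) g(s', r')`, to which Hirota operators are applied. -/
def extProd (f g : 𝕜 → 𝕜 → 𝕜) : DoubledFun 𝕜 := fun s r s' r' => f s r * g s' r'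

/-- The functions `f₁, f₂, f₃` are the first three partial derivatives of `f` in the first
variable. -/
structure IsThreeJet (f f₁ f₂ f₃ : 𝕜 → 𝕜 → 𝕜) : Prop where
  one : ∀ s r, HasDerivAt (fun x => f x r) (f₁ s r) s
  two : ∀ s r, HasDerivAt (fun x => f₁ x r) (f₂ s r) s
  three : ∀ s r, HasDerivAt (fun x => f₂ x r) (f₃ s r) s

variable {f f₁ f₂ f₃ g g₁ g₂ g₃ : 𝕜 → 𝕜 → 𝕜}

theorem hirotaDs_sub_one (a : 𝕜) (hf : IsThreeJet f f₁ f₂ f₃) (hg : IsThreeJet g g₁ g₂ g₃) :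
    (hirotaDs - a • id : DoubledFun 𝕜 → DoubledFun 𝕜) (extProd f g) = fun s r s' r' =>
      f₁ s r * g s' r' - f s r * g₁ s' r' - a * (f s r * g s' r') := by
  exact hirotaDs_sub_smul_eq a (fun s r s' r' => (hf.one s r).mul_const (g s' r'))
    (fun s r s' r' => (hg.one s' r').const_mul (f s r)) fun _ _ _ _ => rfl

theorem hirotaDs_sub_two (a : 𝕜) (hf : IsThreeJet f f₁ f₂ f₃) (hg : IsThreeJet g g₁ g₂ g₃) :
    (hirotaDs - a • id : DoubledFun 𝕜 → DoubledFun 𝕜)^[2] (extProd f g) = fun s r s' r' =>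
      f₂ s r * g s' r' - 2 * (f₁ s r * g₁ s' r') + f s r * g₂ s' r'
      - 2 * a * (f₁ s r * g s' r' - f s r * g₁ s' r') + a ^ 2 * (f s r * g s' r') := by
  rw [Function.iterate_succ_apply', Function.iterate_one, hirotaDs_sub_one a hf hg]
  refine hirotaDs_sub_smul_eq a
    (fun s r s' r' => (((hf.two s r).mul_const (g s' r')).sub
      ((hf.one s r).mul_const (g₁ s' r'))).sub (((hf.one s r).mul_const (g s' r')).const_mul a))
    (fun s r s' r' => (((hg.one s' r').const_mul (f₁ s r)).sub
      ((hg.two s' r').const_mul (f s r))).sub (((hg.one s' r').const_mul (f s r)).const_mul a))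
    fun s r s' r' => ?_
  ring

theorem hirotaDs_sub_three (a : 𝕜) (hf : IsThreeJet f f₁ f₂ f₃) (hg : IsThreeJet g g₁ g₂ g₃) :
    (hirotaDs - a • id : DoubledFun 𝕜 → DoubledFun 𝕜)^[3] (extProd f g) = fun s r s' r' =>
      f₃ s r * g s' r' - 3 * (f₂ s r * g₁ s' r') + 3 * (f₁ s r * g₂ s' r') - f s r * g₃ s' r'
      - 3 * a * (f₂ s r * g s' r' - 2 * (f₁ s r * g₁ s' r') + f s r * g₂ s' r')
      + 3 * a ^ 2 * (f₁ s r * g s' r' - f s r * g₁ s' r') - a ^ 3 * (f s r * g s' r') := by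
  rw [Function.iterate_succ_apply', hirotaDs_sub_two a hf hg]
  refine hirotaDs_sub_smul_eq a
    (fun s r s' r' => (((((hf.three s r).mul_const (g s' r')).sub
      (((hf.two s r).mul_const (g₁ s' r')).const_mul 2)).add
      ((hf.one s r).mul_const (g₂ s' r'))).sub
      ((((hf.two s r).mul_const (g s' r')).sub
      ((hf.one s r).mul_const (g₁ s' r'))).const_mul (2 * a))).add
      (((hf.one s r).mul_const (g s' r')).const_mul (a ^ 2)))
    (fun s r s' r' => (((((hg.one s' r').const_mul (f₂ s r)).sub
      (((hg.two s' r').const_mul (f₁ s r)).const_mul 2)).add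
      ((hg.three s' r').const_mul (f s r))).sub
      ((((hg.one s' r').const_mul (f₁ s r)).sub
      ((hg.two s' r').const_mul (f s r))).const_mul (2 * a))).add
      (((hg.one s' r').const_mul (f s r)).const_mul (a ^ 2))) fun s r s' r' => ?_
  ring

theorem hirotaDr_extProd {fr gr : 𝕜 → 𝕜 → 𝕜}
    (hf : ∀ s r, HasDerivAt (fun x => f s x) (fr s r) r)
    (hg : ∀ s r, HasDerivAt (fun x => g s x) (gr s r) r) :
    hirotaDr (extProd f g) = fun s r s' r' => fr s r * g s' r' - f s r * gr s' r' := by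
  funext s r s' r'
  simp only [hirotaDr, extProd]
  rw [((hf s r).mul_const (g s' r')).deriv, ((hg s' r').const_mul (f s r)).deriv]

end Hirota

/-! ### Diagonal congruence -/

section Scaling

/-- The rule `Pf(D A D) = det D · Pf A` for a diagonal matrix `D`. -/
theorem pfaffian_conj_diagonal {R : Type*} [CommRing R] {n : ℕ} (d : Fin n → R)
    (A : Matrix (Fin n) (Fin n) R) :
    pfaffian (Matrix.of fun i j => d i * A i j * d j) = (∏ i, d i) * pfaffian A := by
  induction n using Nat.twoStepInduction with
  | zero => simp [pfaffian]
  | one => simp [pfaffian]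
  | more n ih _ =>
    rw [pfaffian, pfaffian, Finset.mul_sum]
    refine Finset.sum_congr rfl fun j _ => ?_
    have h := ih (fun i => d (j.succAbove i).succ)
      (A.submatrix (fun i => (j.succAbove i).succ) fun i => (j.succAbove i).succ)
    rw [Fin.prod_univ_succ, Fin.prod_univ_succAbove _ j]
    calc _ = (-1) ^ (j : ℕ) * (d 0 * A 0 j.succ * d j.succ) *
          pfaffian (Matrix.of fun i k => d (j.succAbove i).succ *
            A.submatrix (fun i => (j.succAbove i).succ) (fun i => (j.succAbove i).succ) i k *
              d (j.succAbove k).succ) := rfl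
      _ = _ := by rw [h]; ring

end Scaling

/-! ### The matrix of the tau function -/

section Tau

variable {𝕜 : Type*} [RCLike 𝕜]

theorem hasDerivAt_phi_left (b p ξ₀ : 𝕜) (l : ℤ) (s r : 𝕜) :
    HasDerivAt (fun x => phi b p ξ₀ l x r) (phi b p ξ₀ l s r / p) s := by
  have h : HasDerivAt (fun x => phase p ξ₀ x r) (1 / p) s :=
    (((hasDerivAt_id s).div_const p).add_const _).add_const _
  refine (((hasDerivAt_exp (x := phase p ξ₀ s r)).comp s h).const_mul
    (((1 + b * p) / (1 - b * p)) ^ l)).congr_deriv ?_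
  rw [phi]
  ring

theorem hasDerivAt_phi_right (b p ξ₀ : 𝕜) (l : ℤ) (s r : 𝕜) :
    HasDerivAt (fun x => phi b p ξ₀ l s x) (phi b p ξ₀ l s r / p ^ 3) r := by
  have h : HasDerivAt (fun x => phase p ξ₀ s x) (1 / p ^ 3) r :=
    (((hasDerivAt_id r).div_const (p ^ 3)).const_add _).add_const _
  refine (((hasDerivAt_exp (x := phase p ξ₀ s r)).comp r h).const_mul
    (((1 + b * p) / (1 - b * p)) ^ l)).congr_deriv ?_
  rw [phi]
  ring

theorem contDiff_phi (b p ξ₀ : 𝕜) (l : ℤ) :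
    ContDiff 𝕜 ∞ fun x : 𝕜 × 𝕜 => phi b p ξ₀ l x.1 x.2 := by
  have hexp : ContDiff 𝕜 ∞ (NormedSpace.exp : 𝕜 → 𝕜) :=
    contDiff_iff_contDiffAt.mpr fun x => (NormedSpace.exp_analytic x).contDiffAt
  refine contDiff_const.mul (hexp.comp ?_)
  unfold phase
  fun_prop

variable {n : ℕ} (b : 𝕜) (p ξ₀ : Fin n → 𝕜) (c : Matrix (Fin n) (Fin n) 𝕜) (l : ℤ)

/-- The matrix whose Pfaffian is `τ_l(s, r)`. -/
noncomputable def tauMatrix (s r : 𝕜) : Matrix (Fin n) (Fin n) 𝕜 :=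
  Matrix.of fun i j => c i j +
    (p i - p j) / (p i + p j) * phi b (p i) (ξ₀ i) l s r * phi b (p j) (ξ₀ j) l s r

/-- The vector with entries `φ_i / p_i ^ k`. Differentiation in `s` raises `k` by one,
differentiation in `r` by three. -/
noncomputable def phiVec (k : ℕ) (s r : 𝕜) : Fin n → 𝕜 :=
  fun i => phi b (p i) (ξ₀ i) l s r / p i ^ k

/-- The vector with entries `φ_i / (1 - b p_i)`, which governs the shift of `l`. -/
noncomputable def shiftVec (s r : 𝕜) : Fin n → 𝕜 :=
  fun i => phi b (p i) (ξ₀ i) l s r / (1 - b * p i)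

theorem hasDerivAt_phiVec_left (k : ℕ) (s r : 𝕜) (i : Fin n) :
    HasDerivAt (fun x => phiVec b p ξ₀ l k x r i) (phiVec b p ξ₀ l (k + 1) s r i) s := by
  refine ((hasDerivAt_phi_left b (p i) (ξ₀ i) l s r).div_const _).congr_deriv ?_
  rw [phiVec, div_div, pow_succ']

theorem hasDerivAt_phiVec_right (k : ℕ) (s r : 𝕜) (i : Fin n) :
    HasDerivAt (fun x => phiVec b p ξ₀ l k s x i) (phiVec b p ξ₀ l (k + 3) s r i) r := by
  refine ((hasDerivAt_phi_right b (p i) (ξ₀ i) l s r).div_const _).congr_deriv ?_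
  rw [phiVec, div_div, add_comm k, pow_add]

variable {b p c}

/-- From `1 / (p (1 - b p)) = 1 / p + b / (1 - b p)`. -/
theorem hasDerivAt_shiftVec_left (hp : ∀ i, p i ≠ 0) (hb : ∀ i, 1 - b * p i ≠ 0) (s r : 𝕜)
    (i : Fin n) :
    HasDerivAt (fun x => shiftVec b p ξ₀ l x r i)
      ((phiVec b p ξ₀ l 1 s r + b • shiftVec b p ξ₀ l s r) i) s := by
  refine ((hasDerivAt_phi_left b (p i) (ξ₀ i) l s r).div_const _).congr_deriv ?_
  simp only [phiVec, shiftVec, Pi.add_apply, Pi.smul_apply, smul_eq_mul]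
  have hi := hp i
  have hbi : 1 - p i * b ≠ 0 := by simpa only [mul_comm] using hb i
  rw [mul_comm b (p i)]
  field_simp
  ring

theorem hasDerivAt_shiftVec_right (hp : ∀ i, p i ≠ 0) (hb : ∀ i, 1 - b * p i ≠ 0) (s r : 𝕜)
    (i : Fin n) :
    HasDerivAt (fun x => shiftVec b p ξ₀ l s x i)
      ((phiVec b p ξ₀ l 3 s r + b • phiVec b p ξ₀ l 2 s r + b ^ 2 • phiVec b p ξ₀ l 1 s r +
        b ^ 3 • shiftVec b p ξ₀ l s r) i) r := by
  refine ((hasDerivAt_phi_right b (p i) (ξ₀ i) l s r).div_const _).congr_deriv ?_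
  simp only [phiVec, shiftVec, Pi.add_apply, Pi.smul_apply, smul_eq_mul]
  have hi := hp i
  have hbi : 1 - p i * b ≠ 0 := by simpa only [mul_comm] using hb i
  rw [mul_comm b (p i)]
  field_simp
  ring

theorem transpose_tauMatrix (hc : ∀ i j, c i j = -c j i) (s r : 𝕜) :
    (tauMatrix b p ξ₀ c l s r).transpose = -tauMatrix b p ξ₀ c l s r := by
  ext i j
  simp only [tauMatrix, Matrix.transpose_apply, Matrix.of_apply, Matrix.neg_apply]
  rw [hc j i, add_comm (p j), ← neg_sub (p i)]
  ring

/-- The diagonal case holds because `p i ≠ 0`. -/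
theorem add_ne_zero_of_pairwise (hp : ∀ i, p i ≠ 0) (hpp : ∀ i j, i ≠ j → p i + p j ≠ 0)
    (i j : Fin n) : p i + p j ≠ 0 := by
  rcases eq_or_ne i j with rfl | h
  · rw [← two_mul]
    exact mul_ne_zero two_ne_zero (hp i)
  · exact hpp i j h

/-- The `s`-derivative of the matrix has rank two, since the factor `1 / p_i + 1 / p_j` cancels the
denominator `p_i + p_j`. -/
theorem hasDerivAt_tauMatrix_left (hp : ∀ i, p i ≠ 0) (hpp : ∀ i j, i ≠ j → p i + p j ≠ 0)
    (s r : 𝕜) (i j : Fin n) :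
    HasDerivAt (fun x => tauMatrix b p ξ₀ c l x r i j)
      ((wedge (phiVec b p ξ₀ l 0 s r) (phiVec b p ξ₀ l 1 s r) + wedge 0 0 :
        Matrix (Fin n) (Fin n) 𝕜) i j) s := by
  refine (((hasDerivAt_phi_left b (p i) (ξ₀ i) l s r).const_mul
    ((p i - p j) / (p i + p j))).mul
    (hasDerivAt_phi_left b (p j) (ξ₀ j) l s r)).const_add (c i j) |>.congr_deriv ?_
  have h := add_ne_zero_of_pairwise hp hpp i j
  have hi := hp i
  have hj := hp j
  simp only [wedge, phiVec, Matrix.add_apply, Matrix.sub_apply, Matrix.vecMulVec_apply,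
    Pi.zero_apply]
  field_simp
  ring

/-- The `r`-derivative of the matrix, from
`(1/q - 1/p) (1/p² - 1/(p q) + 1/q²) = (1/q³ - 1/p³) - 2 (1/(p q²) - 1/(p² q))`. -/
theorem hasDerivAt_tauMatrix_right (hp : ∀ i, p i ≠ 0) (hpp : ∀ i j, i ≠ j → p i + p j ≠ 0)
    (s r : 𝕜) (i j : Fin n) :
    HasDerivAt (fun x => tauMatrix b p ξ₀ c l s x i j)
      ((wedge (phiVec b p ξ₀ l 0 s r) (phiVec b p ξ₀ l 3 s r) +
        wedge ((-2 : 𝕜) • phiVec b p ξ₀ l 1 s r) (phiVec b p ξ₀ l 2 s r)) i j) r := by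
  refine (((hasDerivAt_phi_right b (p i) (ξ₀ i) l s r).const_mul
    ((p i - p j) / (p i + p j))).mul
    (hasDerivAt_phi_right b (p j) (ξ₀ j) l s r)).const_add (c i j) |>.congr_deriv ?_
  have h := add_ne_zero_of_pairwise hp hpp i j
  have hi := hp i
  have hj := hp j
  simp only [wedge, phiVec, Matrix.add_apply, Matrix.sub_apply, Matrix.vecMulVec_apply,
    Pi.smul_apply, smul_eq_mul]
  field_simp
  ring

/-- The shift of `l` is a rank-two update. -/
theorem tauMatrix_add_one (hp : ∀ i, p i ≠ 0) (hpp : ∀ i j, i ≠ j → p i + p j ≠ 0)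
    (hb : ∀ i, 1 - b * p i ≠ 0) (hb' : ∀ i, 1 + b * p i ≠ 0) (s r : 𝕜) :
    tauMatrix b p ξ₀ c (l + 1) s r = tauMatrix b p ξ₀ c l s r +
      wedge ((2 : 𝕜) • shiftVec b p ξ₀ l s r) (phiVec b p ξ₀ l 0 s r) := by
  have hphi (i : Fin n) : phi b (p i) (ξ₀ i) (l + 1) s r =
      (1 + b * p i) / (1 - b * p i) * phi b (p i) (ξ₀ i) l s r := by
    rw [phi, phi, zpow_add_one₀ (div_ne_zero (hb' i) (hb i))]
    ring
  ext i j
  have h := add_ne_zero_of_pairwise hp hpp i j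
  have hi : 1 - p i * b ≠ 0 := by simpa only [mul_comm] using hb i
  have hj : 1 - p j * b ≠ 0 := by simpa only [mul_comm] using hb j
  simp only [tauMatrix, wedge, phiVec, shiftVec, Matrix.add_apply, Matrix.sub_apply,
    Matrix.vecMulVec_apply, Matrix.of_apply, Pi.smul_apply, smul_eq_mul, hphi,
    mul_comm b]
  field_simp
  ring

end Tau

/-! ### Derivatives of the tau functions -/

section TauDerivatives

variable {𝕜 : Type*} [RCLike 𝕜] {n : ℕ} (b : 𝕜) (p ξ₀ : Fin n → 𝕜)
  (c : Matrix (Fin n) (Fin n) 𝕜) (l : ℤ)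

/-- The Pfaffian pairing of the vectors `φ / p ^ i` and `φ / p ^ j`. -/
noncomputable def phiPair (i j : ℕ) (s r : 𝕜) : 𝕜 :=
  pfTwo (tauMatrix b p ξ₀ c l s r) (phiVec b p ξ₀ l i s r) (phiVec b p ξ₀ l j s r)

/-- The Pfaffian pairing of the vectors `φ / (1 - b p)` and `φ / p ^ j`. -/
noncomputable def shiftPair (j : ℕ) (s r : 𝕜) : 𝕜 :=
  pfTwo (tauMatrix b p ξ₀ c l s r) (shiftVec b p ξ₀ l s r) (phiVec b p ξ₀ l j s r)

/-- The four-vector Pfaffian of `φ / (1 - b p)` and of `φ / p ^ j` for `j = 0, 1, 2`, the only one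
which enters the bilinear equation. -/
noncomputable def shiftQuad (s r : 𝕜) : 𝕜 :=
  pfFour (tauMatrix b p ξ₀ c l s r) (shiftVec b p ξ₀ l s r) (phiVec b p ξ₀ l 0 s r)
    (phiVec b p ξ₀ l 1 s r) (phiVec b p ξ₀ l 2 s r)

variable {b p ξ₀ c l}
variable (hc : ∀ i j, c i j = -c j i) (hp : ∀ i, p i ≠ 0)
  (hpp : ∀ i j, i ≠ j → p i + p j ≠ 0)

include hc in
theorem phiPair_self (j : ℕ) (s r : 𝕜) : phiPair b p ξ₀ c l j j s r = 0 :=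
  pfTwo_self (transpose_tauMatrix ξ₀ l hc s r) _

include hc in
theorem phiPair_swap (i j : ℕ) (s r : 𝕜) :
    phiPair b p ξ₀ c l i j s r = -phiPair b p ξ₀ c l j i s r :=
  pfTwo_swap (transpose_tauMatrix ξ₀ l hc s r) _ _

include hc hp hpp

theorem hasDerivAt_pfaffian_tauMatrix_left (s r : 𝕜) :
    HasDerivAt (fun x => pfaffian (tauMatrix b p ξ₀ c l x r)) (phiPair b p ξ₀ c l 0 1 s r) s := by
  have hA := transpose_tauMatrix (b := b) (p := p) ξ₀ l hc s r
  refine (hasDerivAt_pfaffian (A := fun x => tauMatrix b p ξ₀ c l x r) hA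
    (hasDerivAt_tauMatrix_left ξ₀ l hp hpp s r)).congr_deriv ?_
  rw [pfTwo_self hA, add_zero, phiPair]

theorem hasDerivAt_pfaffian_tauMatrix_right (s r : 𝕜) :
    HasDerivAt (fun x => pfaffian (tauMatrix b p ξ₀ c l s x))
      (phiPair b p ξ₀ c l 0 3 s r - 2 * phiPair b p ξ₀ c l 1 2 s r) r := by
  have hA := transpose_tauMatrix (b := b) (p := p) ξ₀ l hc s r
  refine (hasDerivAt_pfaffian (A := fun x => tauMatrix b p ξ₀ c l s x) hA
    (hasDerivAt_tauMatrix_right ξ₀ l hp hpp s r)).congr_deriv ?_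
  rw [pfTwo_smul_left hA, phiPair, phiPair]
  ring

theorem hasDerivAt_phiPair_zero_left (j : ℕ) (s r : 𝕜) :
    HasDerivAt (fun x => phiPair b p ξ₀ c l 0 j x r)
      (phiPair b p ξ₀ c l 1 j s r + phiPair b p ξ₀ c l 0 (j + 1) s r) s := by
  have hA := transpose_tauMatrix (b := b) (p := p) ξ₀ l hc s r
  refine (hasDerivAt_pfTwo (A := fun x => tauMatrix b p ξ₀ c l x r) hA
    (hasDerivAt_tauMatrix_left ξ₀ l hp hpp s r)
    (hasDerivAt_phiVec_left b p ξ₀ l 0 s r)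
    (hasDerivAt_phiVec_left b p ξ₀ l j s r)).congr_deriv ?_
  rw [pfFour_self_right hA, pfFour_swap_left hA, pfFour_self_mid hA, phiPair, phiPair]
  ring

theorem isThreeJet_pfaffian_tauMatrix :
    IsThreeJet (fun s r => pfaffian (tauMatrix b p ξ₀ c l s r)) (phiPair b p ξ₀ c l 0 1)
      (phiPair b p ξ₀ c l 0 2)
      (fun s r => phiPair b p ξ₀ c l 1 2 s r + phiPair b p ξ₀ c l 0 3 s r) where
  one := hasDerivAt_pfaffian_tauMatrix_left hc hp hpp
  two s r := (hasDerivAt_phiPair_zero_left hc hp hpp 1 s r).congr_deriv (by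
    rw [phiPair_self hc, zero_add])
  three := hasDerivAt_phiPair_zero_left hc hp hpp 2

variable (hb : ∀ i, 1 - b * p i ≠ 0)
include hb

theorem hasDerivAt_shiftPair_left (j : ℕ) (s r : 𝕜) :
    HasDerivAt (fun x => shiftPair b p ξ₀ c l j x r)
      (phiPair b p ξ₀ c l 1 j s r + b * shiftPair b p ξ₀ c l j s r +
        shiftPair b p ξ₀ c l (j + 1) s r +
        pfFour (tauMatrix b p ξ₀ c l s r) (shiftVec b p ξ₀ l s r) (phiVec b p ξ₀ l j s r)
          (phiVec b p ξ₀ l 0 s r) (phiVec b p ξ₀ l 1 s r)) s := by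
  have hA := transpose_tauMatrix (b := b) (p := p) ξ₀ l hc s r
  refine (hasDerivAt_pfTwo (A := fun x => tauMatrix b p ξ₀ c l x r) hA
    (hasDerivAt_tauMatrix_left ξ₀ l hp hpp s r)
    (hasDerivAt_shiftVec_left ξ₀ l hp hb s r)
    (hasDerivAt_phiVec_left b p ξ₀ l j s r)).congr_deriv ?_
  rw [pfFour_self_right hA, pfTwo_add_left hA, pfTwo_smul_left hA, phiPair, shiftPair, shiftPair]
  ring

theorem hasDerivAt_shiftPair_zero_left (s r : 𝕜) :
    HasDerivAt (fun x => shiftPair b p ξ₀ c l 0 x r)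
      (-phiPair b p ξ₀ c l 0 1 s r + b * shiftPair b p ξ₀ c l 0 s r +
        shiftPair b p ξ₀ c l 1 s r) s := by
  have hA := transpose_tauMatrix (b := b) (p := p) ξ₀ l hc s r
  refine (hasDerivAt_shiftPair_left hc hp hpp hb 0 s r).congr_deriv ?_
  rw [pfFour_self_mid hA, phiPair_swap hc 1 0]
  ring

theorem hasDerivAt_shiftPair_one_left (s r : 𝕜) :
    HasDerivAt (fun x => shiftPair b p ξ₀ c l 1 x r)
      (b * shiftPair b p ξ₀ c l 1 s r + shiftPair b p ξ₀ c l 2 s r) s := by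
  have hA := transpose_tauMatrix (b := b) (p := p) ξ₀ l hc s r
  refine (hasDerivAt_shiftPair_left hc hp hpp hb 1 s r).congr_deriv ?_
  rw [pfFour_swap_right hA, pfFour_self_mid hA, phiPair_self hc]
  ring

theorem hasDerivAt_shiftPair_two_left (s r : 𝕜) :
    HasDerivAt (fun x => shiftPair b p ξ₀ c l 2 x r)
      (phiPair b p ξ₀ c l 1 2 s r + b * shiftPair b p ξ₀ c l 2 s r +
        shiftPair b p ξ₀ c l 3 s r + shiftQuad b p ξ₀ c l s r) s := by
  have hA := transpose_tauMatrix (b := b) (p := p) ξ₀ l hc s r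
  refine (hasDerivAt_shiftPair_left hc hp hpp hb 2 s r).congr_deriv ?_
  rw [pfFour_swap_mid hA, pfFour_swap_right hA, neg_neg, shiftQuad]

theorem hasDerivAt_shiftPair_zero_right (s r : 𝕜) :
    HasDerivAt (fun x => shiftPair b p ξ₀ c l 0 s x)
      (-phiPair b p ξ₀ c l 0 3 s r - b * phiPair b p ξ₀ c l 0 2 s r
        - b ^ 2 * phiPair b p ξ₀ c l 0 1 s r + b ^ 3 * shiftPair b p ξ₀ c l 0 s r
        + shiftPair b p ξ₀ c l 3 s r - 2 * shiftQuad b p ξ₀ c l s r) r := by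
  have hA := transpose_tauMatrix (b := b) (p := p) ξ₀ l hc s r
  refine (hasDerivAt_pfTwo (A := fun x => tauMatrix b p ξ₀ c l s x) hA
    (hasDerivAt_tauMatrix_right ξ₀ l hp hpp s r)
    (hasDerivAt_shiftVec_right ξ₀ l hp hb s r)
    (hasDerivAt_phiVec_right b p ξ₀ l 0 s r)).congr_deriv ?_
  rw [pfFour_self_mid hA, pfFour_smul_third hA]
  simp only [pfTwo_add_left hA, pfTwo_smul_left hA]
  have e (j : ℕ) := phiPair_swap (b := b) (p := p) (ξ₀ := ξ₀) (l := l) hc j 0 s r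
  simp only [phiPair] at e
  simp only [phiPair, shiftPair, shiftQuad]
  linear_combination e 3 + b * e 2 + b ^ 2 * e 1

/-- The first three `s`-derivatives of `τ_{l+1}`, expressed through data at the lattice site
`l`. -/
theorem isThreeJet_shifted :
    IsThreeJet
      (fun s r => pfaffian (tauMatrix b p ξ₀ c l s r) + 2 * shiftPair b p ξ₀ c l 0 s r)
      (fun s r => phiPair b p ξ₀ c l 0 1 s r +
        2 * (-phiPair b p ξ₀ c l 0 1 s r + b * shiftPair b p ξ₀ c l 0 s r +
          shiftPair b p ξ₀ c l 1 s r))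
      (fun s r => -phiPair b p ξ₀ c l 0 2 s r - 2 * b * phiPair b p ξ₀ c l 0 1 s r +
        2 * b ^ 2 * shiftPair b p ξ₀ c l 0 s r + 4 * b * shiftPair b p ξ₀ c l 1 s r +
          2 * shiftPair b p ξ₀ c l 2 s r)
      (fun s r => phiPair b p ξ₀ c l 1 2 s r - phiPair b p ξ₀ c l 0 3 s r -
        2 * b * phiPair b p ξ₀ c l 0 2 s r - 2 * b ^ 2 * phiPair b p ξ₀ c l 0 1 s r +
        2 * b ^ 3 * shiftPair b p ξ₀ c l 0 s r + 6 * b ^ 2 * shiftPair b p ξ₀ c l 1 s r +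
        6 * b * shiftPair b p ξ₀ c l 2 s r + 2 * shiftPair b p ξ₀ c l 3 s r +
        2 * shiftQuad b p ξ₀ c l s r) where
  one s r := ((isThreeJet_pfaffian_tauMatrix hc hp hpp).one s r).add
    ((hasDerivAt_shiftPair_zero_left hc hp hpp hb s r).const_mul 2)
  two s r := by
    have h0 := hasDerivAt_shiftPair_zero_left (ξ₀ := ξ₀) (l := l) hc hp hpp hb s r
    have h1 := hasDerivAt_shiftPair_one_left (ξ₀ := ξ₀) (l := l) hc hp hpp hb s r
    have ht := (isThreeJet_pfaffian_tauMatrix (b := b) (ξ₀ := ξ₀) (l := l) hc hp hpp).two s r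
    refine (ht.add (((ht.neg.add (h0.const_mul b)).add h1).const_mul 2)).congr_deriv ?_
    ring
  three s r := by
    have h0 := hasDerivAt_shiftPair_zero_left (ξ₀ := ξ₀) (l := l) hc hp hpp hb s r
    have h1 := hasDerivAt_shiftPair_one_left (ξ₀ := ξ₀) (l := l) hc hp hpp hb s r
    have h2 := hasDerivAt_shiftPair_two_left (ξ₀ := ξ₀) (l := l) hc hp hpp hb s r
    have ht := (isThreeJet_pfaffian_tauMatrix (b := b) (ξ₀ := ξ₀) (l := l) hc hp hpp).two s r
    have ht' := (isThreeJet_pfaffian_tauMatrix (b := b) (ξ₀ := ξ₀) (l := l) hc hp hpp).three s r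
    refine ((((ht'.neg.sub (ht.const_mul (2 * b))).add (h0.const_mul (2 * b ^ 2))).add
      (h1.const_mul (4 * b))).add (h2.const_mul 2)).congr_deriv ?_
    ring

end TauDerivatives

/-! ### The bilinear equations -/

section Main

variable {𝕜 : Type*} [RCLike 𝕜] {N : ℕ} {b : 𝕜} {p ξ₀ : Fin (2 * N) → 𝕜}
  {c : Matrix (Fin (2 * N)) (Fin (2 * N)) 𝕜}

theorem contDiff_tau (l : ℤ) : ContDiff 𝕜 ∞ (fun x : 𝕜 × 𝕜 => tau b p ξ₀ c l x.1 x.2) := by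
  refine contDiff_pfaffian.comp (f := fun (x : 𝕜 × 𝕜) i j => c i j +
    (p i - p j) / (p i + p j) * phi b (p i) (ξ₀ i) l x.1 x.2 * phi b (p j) (ξ₀ j) l x.1 x.2)
    (contDiff_pi.mpr fun i => contDiff_pi.mpr fun j => ?_)
  exact contDiff_const.add ((contDiff_const.mul (contDiff_phi _ _ _ _)).mul (contDiff_phi _ _ _ _))

section

variable (hc : ∀ i j, c i j = -c j i) (hp : ∀ i, p i ≠ 0)
  (hpp : ∀ i j, i ≠ j → p i + p j ≠ 0) (hb : ∀ i, 1 - b * p i ≠ 0) (hb' : ∀ i, 1 + b * p i ≠ 0)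

include hc hp hpp hb hb' in
theorem tau_add_one (l : ℤ) : tau b p ξ₀ c (l + 1) = fun s r =>
    pfaffian (tauMatrix b p ξ₀ c l s r) + 2 * shiftPair b p ξ₀ c l 0 s r := by
  funext s r
  have hA := transpose_tauMatrix (b := b) (p := p) ξ₀ l hc s r
  rw [shiftPair, ← pfTwo_smul_left hA, pfTwo, ← tauMatrix_add_one ξ₀ l hp hpp hb hb']
  simp [tau, tauMatrix]

include hc hp hpp hb hb' in
theorem hirota_tau (l : ℤ) (s r : 𝕜) :
    hirota ((hirotaDs - b • id)^[3] - (hirotaDr - b ^ 3 • id))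
      (tau b p ξ₀ c (l + 1)) (tau b p ξ₀ c l) s r = 0 := by
  have h0 : tau b p ξ₀ c l = fun s r => pfaffian (tauMatrix b p ξ₀ c l s r) := rfl
  rw [tau_add_one hc hp hpp hb hb', h0]
  have hjf := isThreeJet_shifted (ξ₀ := ξ₀) (l := l) hc hp hpp hb
  have hjg := isThreeJet_pfaffian_tauMatrix (b := b) (ξ₀ := ξ₀) (l := l) hc hp hpp
  have h3 := congrFun (congrFun (congrFun (congrFun (hirotaDs_sub_three b hjf hjg) s) r) s) r
  have hrg := hasDerivAt_pfaffian_tauMatrix_right (b := b) (ξ₀ := ξ₀) (l := l) hc hp hpp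
  have hr := congrFun (congrFun (congrFun (congrFun (hirotaDr_extProd
    (fun s r => (hrg s r).add
      ((hasDerivAt_shiftPair_zero_right (ξ₀ := ξ₀) (l := l) hc hp hpp hb s r).const_mul 2))
    hrg) s) r) s) r
  have hpl := pfFour_plucker (transpose_tauMatrix (b := b) (p := p) ξ₀ l hc s r)
    (shiftVec b p ξ₀ l s r) (phiVec b p ξ₀ l 0 s r) (phiVec b p ξ₀ l 1 s r)
    (phiVec b p ξ₀ l 2 s r)
  change _ * shiftQuad b p ξ₀ c l s r = shiftPair b p ξ₀ c l 0 s r * phiPair b p ξ₀ c l 1 2 s r -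
    shiftPair b p ξ₀ c l 1 s r * phiPair b p ξ₀ c l 0 2 s r +
    shiftPair b p ξ₀ c l 2 s r * phiPair b p ξ₀ c l 0 1 s r at hpl
  refine Eq.trans (congrArg₂ (· - ·) h3 (congrArg₂ (· - ·) hr rfl)) ?_
  simp only [Pi.add_apply, Pi.smul_apply, id, smul_eq_mul]
  -- all terms cancel identically, except those of the four-vector identity
  linear_combination 6 * hpl

end

section Reduction

/-- Under the reduction conditions, `τ_l` is constant along the direction `∂_r - b² ∂_s`. Along this
direction `φ_i` is multiplied by `exp (κ_i t)` with `κ_i = 1 / p_i ^ 3 - b ^ 2 / p_i`, and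
`κ_i + κ_j = 0` wherever `c i j ≠ 0`; so the matrix undergoes a diagonal congruence, of determinant
`1` because `∑ κ_i = 0`. -/
theorem tau_flow (hp : ∀ i, p i ≠ 0)
    (hc : ∀ i j, j ≠ Fin.rev i → c i j = 0)
    (hred : ∀ i, p i ^ 3 * (1 - b ^ 2 * p (Fin.rev i) ^ 2) =
        - (p (Fin.rev i) ^ 3 * (1 - b ^ 2 * p i ^ 2))) (l : ℤ) (s r t : 𝕜) :
    tau b p ξ₀ c l (s - b ^ 2 * t) (r + t) = tau b p ξ₀ c l s r := by
  set κ : Fin (2 * N) → 𝕜 := fun i => 1 / p i ^ 3 - b ^ 2 / p i with hκ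
  have hrev (i) : κ i + κ i.rev = 0 := by
    have h1 := hp i
    have h2 := hp i.rev
    simp only [hκ]
    field_simp
    linear_combination hred i
  have hsum : ∑ i, κ i = 0 := by
    have h : ∑ i, κ i = -∑ i, κ i := by
      conv_lhs => rw [← Equiv.sum_comp Fin.revPerm]
      rw [← Finset.sum_neg_distrib]
      exact Finset.sum_congr rfl fun i _ => eq_neg_of_add_eq_zero_right (hrev i)
    exact self_eq_neg.mp h
  have hexp (x y : 𝕜) : NormedSpace.exp (x + y) = NormedSpace.exp x * NormedSpace.exp y :=
    NormedSpace.exp_add_of_commute (Commute.all x y)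
  have hphi (i) : phi b (p i) (ξ₀ i) l (s - b ^ 2 * t) (r + t) =
      NormedSpace.exp (κ i * t) * phi b (p i) (ξ₀ i) l s r := by
    have hph : phase (p i) (ξ₀ i) (s - b ^ 2 * t) (r + t) = κ i * t + phase (p i) (ξ₀ i) s r := by
      simp only [phase, hκ]
      ring
    rw [phi, phi, hph, hexp]
    ring
  have hprod : ∏ i, NormedSpace.exp (κ i * t) = (1 : 𝕜) := by
    rw [← NormedSpace.exp_sum, ← Finset.sum_mul, hsum, zero_mul, NormedSpace.exp_zero]
  have hconj := pfaffian_conj_diagonal (fun i => NormedSpace.exp (κ i * t))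
    (tauMatrix b p ξ₀ c l s r)
  rw [hprod, one_mul] at hconj
  refine Eq.trans ?_ hconj
  rw [tau]
  congr 1
  ext i j
  simp only [tauMatrix, Matrix.of_apply, hphi]
  -- either `c i j` vanishes or the two exponentials cancel
  have hcij : c i j = NormedSpace.exp (κ i * t) * c i j * NormedSpace.exp (κ j * t) := by
    by_cases h : j = i.rev
    · rw [mul_right_comm, ← hexp, h, ← add_mul, hrev, zero_mul, NormedSpace.exp_zero, one_mul]
    · rw [hc i j h]
      ring
  linear_combination hcij

theorem deriv_tau_right (hc : ∀ i j, c i j = -c j i) (hp : ∀ i, p i ≠ 0)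
    (hpp : ∀ i j, i ≠ j → p i + p j ≠ 0) (hanti : ∀ i j, j ≠ Fin.rev i → c i j = 0)
    (hred : ∀ i, p i ^ 3 * (1 - b ^ 2 * p (Fin.rev i) ^ 2) =
        - (p (Fin.rev i) ^ 3 * (1 - b ^ 2 * p i ^ 2))) (l : ℤ) (s r : 𝕜) :
    deriv (fun x => tau b p ξ₀ c l s x) r = b ^ 2 * deriv (fun x => tau b p ξ₀ c l x r) s := by
  have hs : HasDerivAt (fun x => tau b p ξ₀ c l x r) _ s :=
    hasDerivAt_pfaffian_tauMatrix_left hc hp hpp s r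
  have hflow : (fun x => tau b p ξ₀ c l s x) =
      fun x => tau b p ξ₀ c l (s + b ^ 2 * (x - r)) r := by
    funext x
    have h := tau_flow (ξ₀ := ξ₀) hp hanti hred l s x (r - x)
    rw [← h]
    congr 1 <;> ring
  have hlin : HasDerivAt (fun x => s + b ^ 2 * (x - r)) (b ^ 2) r := by
    simpa using (((hasDerivAt_id r).sub_const r).const_mul (b ^ 2)).const_add s
  have hs' : HasDerivAt (fun x => tau b p ξ₀ c l x r) (phiPair b p ξ₀ c l 0 1 s r)
      (s + b ^ 2 * (r - r)) := by
    simpa using hs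
  rw [hflow, hs.deriv, mul_comm]
  exact (hs'.comp r hlin).deriv

/-- Once `∂_r = b² ∂_s` on the tau functions, `D_r` acts as `b² D_s`, and expanding `(D_s - b)³`
gives the reduced equation. -/
theorem hirota_tau_reduced (hc : ∀ i j, c i j = -c j i) (hp : ∀ i, p i ≠ 0)
    (hpp : ∀ i j, i ≠ j → p i + p j ≠ 0) (hb : ∀ i, 1 - b * p i ≠ 0)
    (hb' : ∀ i, 1 + b * p i ≠ 0)
    (hdr : ∀ (l : ℤ) (s r : 𝕜), deriv (fun x => tau b p ξ₀ c l s x) r =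
      b ^ 2 * deriv (fun x => tau b p ξ₀ c l x r) s) (l : ℤ) (s r : 𝕜) :
    hirota (hirotaDs^[3] - (3 * b) • hirotaDs^[2] + (2 * b ^ 2) • hirotaDs)
      (tau b p ξ₀ c (l + 1)) (tau b p ξ₀ c l) s r = 0 := by
  have hjg (l : ℤ) := isThreeJet_pfaffian_tauMatrix (b := b) (ξ₀ := ξ₀) (l := l) hc hp hpp
  have hr (l : ℤ) (s r : 𝕜) : HasDerivAt (fun x => tau b p ξ₀ c l s x)
      (b ^ 2 * phiPair b p ξ₀ c l 0 1 s r) r := by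
    rw [← ((hjg l).one s r).deriv]
    refine (hasDerivAt_pfaffian_tauMatrix_right hc hp hpp s r).differentiableAt.hasDerivAt
      |>.congr_deriv (hdr l s r)
  have hmain := hirota_tau (ξ₀ := ξ₀) hc hp hpp hb hb' l s r
  have eval {F G : DoubledFun 𝕜} (h : F = G) : F s r s r = G s r s r := by rw [h]
  have h3 := eval (hirotaDs_sub_three b (hjg (l + 1)) (hjg l))
  have h30 := eval (hirotaDs_sub_three 0 (hjg (l + 1)) (hjg l))
  have h20 := eval (hirotaDs_sub_two 0 (hjg (l + 1)) (hjg l))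
  have h10 := eval (hirotaDs_sub_one 0 (hjg (l + 1)) (hjg l))
  have hr' := eval (hirotaDr_extProd (hr (l + 1)) (hr l))
  -- the shift by `0` gives the plain powers of `D_s`
  rw [zero_smul, sub_zero] at h30 h20 h10
  have hmain' := (congrArg₂ (· - ·) h3 (congrArg₂ (· - ·) hr' rfl)).symm.trans hmain
  refine Eq.trans (congrArg₂ (· + ·) (congrArg₂ (· - ·) h30 (congrArg (3 * b * ·) h20))
    (congrArg (2 * b ^ 2 * ·) h10)) ?_
  simp only [Pi.smul_apply, id, smul_eq_mul, tau] at hmain'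
  simp only [tauMatrix] at hmain' ⊢
  linear_combination hmain'

end Reduction

end Main

theorem mainTheorem4 {𝕜 : Type*} [RCLike 𝕜] (N : ℕ) (b : 𝕜) (p ξ₀ : Fin (2 * N) → 𝕜)
    (c : Matrix (Fin (2 * N)) (Fin (2 * N)) 𝕜)
    (hc : ∀ i j, c i j = - c j i)
    (hp : ∀ i, p i ≠ 0)
    (hpp : ∀ i j, i ≠ j → p i + p j ≠ 0)
    (hb : ∀ i, 1 - b * p i ≠ 0)
    (hb' : ∀ i, 1 + b * p i ≠ 0) :
    -- the functions `τ_l` are smooth, so that the derivatives below are genuine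
    (∀ l : ℤ, ContDiff 𝕜 ∞ (fun x : 𝕜 × 𝕜 => tau b p ξ₀ c l x.1 x.2)) ∧
    -- `((D_s - b)^3 - (D_r - b^3)) τ_{l+1} · τ_l = 0`
    (∀ (l : ℤ) (s r : 𝕜),
      hirota ((hirotaDs - b • id)^[3] - (hirotaDr - b ^ 3 • id))
        (tau b p ξ₀ c (l + 1)) (tau b p ξ₀ c l) s r = 0) ∧
    -- the reduction: `c` lives on the antidiagonal, and `p` satisfies the reduction condition
    ((∀ i j, j ≠ Fin.rev i → c i j = 0) →
      (∀ i, p i ^ 3 * (1 - b ^ 2 * p (Fin.rev i) ^ 2) =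
        - (p (Fin.rev i) ^ 3 * (1 - b ^ 2 * p i ^ 2))) →
      (∀ (l : ℤ) (s r : 𝕜),
        deriv (fun x => tau b p ξ₀ c l s x) r =
          b ^ 2 * deriv (fun x => tau b p ξ₀ c l x r) s) ∧
      (∀ (l : ℤ) (s r : 𝕜),
        hirota (hirotaDs^[3] - (3 * b) • hirotaDs^[2] + (2 * b ^ 2) • hirotaDs)
          (tau b p ξ₀ c (l + 1)) (tau b p ξ₀ c l) s r = 0)) := by
  refine ⟨contDiff_tau, hirota_tau hc hp hpp hb hb', fun hanti hred => ?_⟩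
  have hdr := deriv_tau_right (ξ₀ := ξ₀) hc hp hpp hanti hred
  exact ⟨hdr, hirota_tau_reduced hc hp hpp hb hb' hdr⟩
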